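/- Let $n\ge 1$ and let $\mathrm{Y}(n)=\mathrm{Y}(\mathfrak{gl}_n)$ be the Yangian, i.e. the unital associative algebra over $\mathbb{C}$ with generators $t_{ij}^{(r)}$ ($1\le i,j\le n$, $r\ge 1$) and defining relations $$[t^{(r+1)}_{ij},t^{(s)}_{kl}]-[t^{(r)}_{ij},t^{(s+1)}_{kl}]=t^{(r)}_{kj}t^{(s)}_{il}-t^{(s)}_{kj}t^{(r)}_{il},\qquad r,s\ge 0,\quad t^{(0)}_{ij}=\delta_{ij}.$$ Let $T(u)$ be the $n\times n$ matrix with entries $t_{ij}(u)=\sum_{r\ge 0}t^{(r)}_{ij}u^{-r}\in \mathrm{Y}(n)[[u^{-1}]]$, where shifted series such as $t_{ij}(u-c)$ are re-expanded in powers of $u^{-1}$. Let $T_a(u)$ denote $T(u)$ acting on the $a$-th copy of $\mathbb{C}^n$ in $(\mathbb{C}^n)^{\otimes n}$, and let $A_n$ be the antisymmetrizer, $A_n(e_{i_1}\otimes\cdots\otimes e_{i_n})=\sum_{\sigma\in\mathfrak{S}_n}\operatorname{sgn}\sigma\cdot e_{i_{\sigma(1)}}\otimes\cdots\otimes e_{i_{\sigma(n)}}$.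 The quantum determinant is the series $\operatorname{qdet}T(u)\in 1+u^{-1}\mathrm{Y}(n)[[u^{-1}]]$ such that $$A_n\,T_1(u)\cdots T_n(u-n+1)=T_n(u-n+1)\cdots T_1(u)\,A_n=A_n\,\operatorname{qdet}T(u).$$ For an invertible square matrix $X$ over a ring with $1$ such that $(X^{-1})_{ji}$ is invertible, the $ij$-th quasi-determinant is $|X|_{ij}=\big((X^{-1})_{ji}\big)^{-1}$. For $1\le m\le n$ let $T^{(m)}(u)$ be the submatrix of $T(u)$ formed by its first $m$ rows and columns. Then $\operatorname{qdet}T(u)$ exists and is unique, the quasi-determinants $|T^{(m)}(u-m+1)|_{mm}$ ($1\le m\le n$) over the ring $\mathrm{Y}(n)[[u^{-1}]]$ are defined, $|T^{(1)}(u)|_{11}=t_{11}(u)$, and in $\mathrm{Y}(n)[[u^{-1}]]$ one has $$\operatorname{qdet}T(u)=t_{11}(u)\,|T^{(2)}(u-1)|_{22}\cdots|T^{(n)}(u-n+1)|_{nn}.$$ Moreover, the factors $t_{11}(u),\ |T^{(2)}(u-1)|_{22},\ \dots,\ |T^{(n)}(u-n+1)|_{nn}$ commute pairwise. -/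

import Mathlib

/-! The Yangian of `gl_n` over `ℂ`. Formal power series in `u⁻¹` over a (noncommutative) algebra
`A` are elements of `PowerSeries A`, the variable `PowerSeries.X` standing for `u⁻¹`. Indices
`1, …, n` are represented by `Fin n = {0, …, n - 1}`. -/

namespace Yangian

noncomputable section

/-- The elements `t_{ij}^{(r)}` of the free algebra on the symbols `t_{ij}^{(1)}, t_{ij}^{(2)}, …`,
with the convention `t_{ij}^{(0)} = δ_{ij}`. The free generator with label `(i, j, r)` is
`t_{ij}^{(r+1)}`. -/
def freeT (n : ℕ) (i j : Fin n) : ℕ → FreeAlgebra ℂ (Fin n × Fin n × ℕ)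
  | 0 => if i = j then 1 else 0
  | r + 1 => FreeAlgebra.ι ℂ (i, j, r)

/-- The defining relations
`[t_{ij}^{(r+1)}, t_{kl}^{(s)}] - [t_{ij}^{(r)}, t_{kl}^{(s+1)}]
  = t_{kj}^{(r)} t_{il}^{(s)} - t_{kj}^{(s)} t_{il}^{(r)}`, for `r, s ≥ 0`. -/
inductive Rel (n : ℕ) :
    FreeAlgebra ℂ (Fin n × Fin n × ℕ) → FreeAlgebra ℂ (Fin n × Fin n × ℕ) → Prop
  | defining (i j k l : Fin n) (r s : ℕ) :
      Rel n
        ((freeT n i j (r + 1) * freeT n k l s - freeT n k l s * freeT n i j (r + 1)) -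
          (freeT n i j r * freeT n k l (s + 1) - freeT n k l (s + 1) * freeT n i j r))
        (freeT n k j r * freeT n i l s - freeT n k j s * freeT n i l r)

/-- The Yangian `Y(n) = Y(gl_n)`: the unital associative `ℂ`-algebra with generators
`t_{ij}^{(r)}`, `r ≥ 1`, and the defining relations `Rel n`. -/
abbrev Y (n : ℕ) : Type := RingQuot (Rel n)

/-- The element `t_{ij}^{(r)}` of the Yangian (with `t_{ij}^{(0)} = δ_{ij}`). -/
def t (n : ℕ) (i j : Fin n) (r : ℕ) : Y n := RingQuot.mkAlgHom ℂ (Rel n) (freeT n i j r)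

/-- The matrix `T(u)`, whose entries are the series
`t_{ij}(u) = δ_{ij} + t_{ij}^{(1)} u⁻¹ + t_{ij}^{(2)} u⁻² + ⋯`. -/
def T (n : ℕ) : Matrix (Fin n) (Fin n) (PowerSeries (Y n)) :=
  Matrix.of fun i j => PowerSeries.mk (t n i j)

/-- The expansion `(u - c)⁻¹ = u⁻¹ + c u⁻² + c² u⁻³ + ⋯`. -/
def shiftedVar (c : ℂ) : PowerSeries ℂ := PowerSeries.X * PowerSeries.mk fun k => c ^ k

/-- `shiftedVar c` is `u⁻¹ (1 - c u⁻¹)⁻¹`. -/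
theorem shiftedVar_mul (c : ℂ) :
    shiftedVar c * (1 - PowerSeries.C c * PowerSeries.X) = PowerSeries.X := by
  have h : (PowerSeries.mk fun k => c ^ k) * (1 - PowerSeries.C c * PowerSeries.X) = 1 := by
    ext m
    cases m with
    | zero => simp [mul_sub, PowerSeries.coeff_zero_eq_constantCoeff]
    | succ m =>
      rw [mul_sub, mul_one, mul_comm (PowerSeries.C c), ← mul_assoc]
      simp [PowerSeries.coeff_succ_mul_X, PowerSeries.coeff_one, pow_succ]
  rw [shiftedVar, mul_assoc, h, mul_one]

/-- The series `f(u - c) = ∑_r a_r (u - c)^{-r}`, re-expanded in powers of `u⁻¹`, where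
`f(u) = ∑_r a_r u^{-r}`. As `(u - c)^{-r}` starts with `u^{-r}`, only the terms with `r ≤ m`
contribute to the coefficient of `u^{-m}`. -/
def shift {A : Type*} [Ring A] [Algebra ℂ A] (c : ℂ) (f : PowerSeries A) : PowerSeries A :=
  PowerSeries.mk fun m =>
    ∑ r ∈ Finset.range (m + 1), PowerSeries.coeff m (shiftedVar c ^ r) • PowerSeries.coeff r f

/-- The matrix `T(u - c)`. -/
def shiftedT (n : ℕ) (c : ℂ) : Matrix (Fin n) (Fin n) (PowerSeries (Y n)) :=
  (T n).map (shift c)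

/-- For a matrix `X` over `R`, the element `X_a` of `R ⊗ (End ℂⁿ)^{⊗m}` in which `X` acts on the
`a`-th copy of `ℂⁿ`. The algebra `R ⊗ (End ℂⁿ)^{⊗m}` is realized by the matrices over `R` whose
rows and columns are indexed by multi-indices `Fin m → Fin n`, i.e. by the basis vectors
`e_{i_1} ⊗ ⋯ ⊗ e_{i_m}` of `(ℂⁿ)^{⊗m}`. -/
def onCopy {R : Type*} [Ring R] {n : ℕ} (m : ℕ) (X : Matrix (Fin n) (Fin n) R) (a : Fin m) :
    Matrix (Fin m → Fin n) (Fin m → Fin n) R :=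
  Matrix.of fun I J => if ∀ b, b ≠ a → I b = J b then X (I a) (J a) else 0

/-- The antisymmetrizer `A_m`, sending `e_{i_1} ⊗ ⋯ ⊗ e_{i_m}` to
`∑_σ sgn σ · e_{i_{σ(1)}} ⊗ ⋯ ⊗ e_{i_{σ(m)}}`. -/
def antisymmetrizer (R : Type*) [Ring R] (n m : ℕ) :
    Matrix (Fin m → Fin n) (Fin m → Fin n) R :=
  Matrix.of fun I J => ∑ σ : Equiv.Perm (Fin m),
    if I = J ∘ σ then ((Equiv.Perm.sign σ : ℤ) : R) else 0

/-- The list `T_1(u), T_2(u - 1), …, T_n(u - n + 1)`. -/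
def tList (n : ℕ) : List (Matrix (Fin n → Fin n) (Fin n → Fin n) (PowerSeries (Y n))) :=
  List.ofFn fun a : Fin n => onCopy n (shiftedT n (a.val : ℂ)) a

/-- `D` is the quantum determinant `qdet T(u)`: a series `1 + d_1 u⁻¹ + d_2 u⁻² + ⋯` over `Y(n)`
such that
`A_n T_1(u) ⋯ T_n(u - n + 1) = T_n(u - n + 1) ⋯ T_1(u) A_n = A_n D`. -/
structure IsQuantumDeterminant (n : ℕ) (D : PowerSeries (Y n)) : Prop where
  constantCoeff_eq : PowerSeries.constantCoeff D = 1
  antisymmetrizer_mul :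
    antisymmetrizer (PowerSeries (Y n)) n n * (tList n).prod =
      antisymmetrizer (PowerSeries (Y n)) n n * Matrix.scalar (Fin n → Fin n) D
  mul_antisymmetrizer :
    (tList n).reverse.prod * antisymmetrizer (PowerSeries (Y n)) n n =
      antisymmetrizer (PowerSeries (Y n)) n n * Matrix.scalar (Fin n → Fin n) D

/-- The `ij`-th quasi-determinant of the square matrix `X` is defined: `X` is invertible and the
`ji`-th entry of its inverse is invertible. -/
def HasQuasiDet {R : Type*} [Ring R] {m : ℕ} (X : Matrix (Fin m) (Fin m) R) (i j : Fin m) : Prop :=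
  IsUnit X ∧ IsUnit ((Ring.inverse X) j i)

/-- The `ij`-th quasi-determinant `|X|_{ij} = ((X⁻¹)_{ji})⁻¹`. Here `Ring.inverse` is the two-sided
inverse of an invertible element. -/
def quasiDet {R : Type*} [Ring R] {m : ℕ} (X : Matrix (Fin m) (Fin m) R) (i j : Fin m) : R :=
  Ring.inverse ((Ring.inverse X) j i)

/-- For `k = m - 1` in `{0, …, n - 1}`, the matrix `T^{(m)}(u - m + 1)` formed by the first `m` rows
and columns of `T(u - m + 1)`. -/
def leadingT (n : ℕ) (k : Fin n) :
    Matrix (Fin (k.val + 1)) (Fin (k.val + 1)) (PowerSeries (Y n)) :=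
  (shiftedT n (k.val : ℂ)).submatrix (Fin.castLE k.isLt) (Fin.castLE k.isLt)

/-- For `k = m - 1`, the quasi-determinant `|T^{(m)}(u - m + 1)|_{mm}`. -/
def factor (n : ℕ) (k : Fin n) : PowerSeries (Y n) :=
  quasiDet (leadingT n k) (Fin.last k.val) (Fin.last k.val)

end

end Yangian

/-! With the Yang `R`-matrix the defining relations read `R₁₂(u - v) S₁(u) S₂(v) = S₂(v) S₁(u)
R₁₂(u - v)`. Fusing these relations along the shifts `0, 1, …, m - 1` carries the antisymmetrizer
`A_m` through `S₁(u) ⋯ S_m(u - m + 1)` and reverses the product; both sides being alternating in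
rows and in columns, for an `m × m` matrix they are `A_m qdet S(u)`. Fusing one more copy of
`ℂᵐ` with parameter `u - c` gives `A_{m+1} = 0`, which leaves the statement that `S(u - c)`
commutes with `qdet S(u)`. This is obtained for infinitely many `c` only, but the coefficients
depend polynomially on `c`.

The last row `h` of the quantum comatrix satisfies `h S(u - m + 1) = (0, …, 0, qdet S(u))`, and its
last entry is the quantum determinant of the leading principal submatrix. Hence
`|T^{(m)}(u - m + 1)|_{mm} = qdet T^{(m-1)}(u)⁻¹ qdet T^{(m)}(u)`, so the product of the
quasi-determinants telescopes, and they commute because `qdet T^{(m)}(u)` commutes with the entries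
of `T^{(m)}` and hence with every smaller principal quantum determinant. -/

namespace Yangian

open PowerSeries Finset

section Evaluation

variable {R : Type*} [Ring R] {w : R⟦X⟧}

/-- The value at `w` of a series `F` whose coefficients are themselves series, written to the left
of the powers of `w`. It is meant for `w` without constant term: then only the terms of degree at
most `N` contribute to the coefficient of index `N`. -/
noncomputable def evalSeries (w : R⟦X⟧) (F : R⟦X⟧⟦X⟧) : R⟦X⟧ :=
  mk fun N => coeff N (∑ r ∈ range (N + 1), coeff r F * w ^ r)

theorem coeff_mul_pow_eq_zero (hw : X ∣ w) (f : R⟦X⟧) {N r : ℕ} (h : N < r) :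
    coeff N (f * w ^ r) = 0 := by
  obtain ⟨v, rfl⟩ := hw
  rw [(commute_X v).symm.mul_pow, ← mul_assoc, ← (commute_X_pow f r).eq.symm, mul_assoc,
    coeff_X_pow_mul', if_neg (by omega)]

theorem coeff_evalSeries (hw : X ∣ w) (F : R⟦X⟧⟦X⟧) {N M : ℕ} (h : N < M) :
    coeff N (evalSeries w F) = coeff N (∑ r ∈ range M, coeff r F * w ^ r) := by
  rw [evalSeries, coeff_mk, map_sum, map_sum]
  exact sum_subset (range_subset_range.2 h) fun r _ hr =>
    coeff_mul_pow_eq_zero hw _ (by simpa using hr)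

theorem evalSeries_add (w : R⟦X⟧) (F G : R⟦X⟧⟦X⟧) :
    evalSeries w (F + G) = evalSeries w F + evalSeries w G := by
  ext N
  simp only [evalSeries, coeff_mk, map_add, add_mul, sum_add_distrib]

theorem evalSeries_C_mul (hw : X ∣ w) (f : R⟦X⟧) (F : R⟦X⟧⟦X⟧) :
    evalSeries w (C f * F) = f * evalSeries w F := by
  ext N
  rw [coeff_evalSeries hw _ N.lt_succ_self]
  simp_rw [coeff_C_mul, mul_assoc, ← mul_sum]
  rw [coeff_mul, coeff_mul]
  refine sum_congr rfl fun p hp => ?_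
  rw [coeff_evalSeries hw F (Nat.lt_succ_of_le (HasAntidiagonal.antidiagonal.snd_le hp))]

theorem evalSeries_mul_X (hw : X ∣ w) (F : R⟦X⟧⟦X⟧) :
    evalSeries w (F * X) = evalSeries w F * w := by
  ext N
  rw [coeff_evalSeries hw _ (show N < N + 1 + 1 by omega), sum_range_succ']
  simp_rw [coeff_succ_mul_X, coeff_zero_mul_X, zero_mul, add_zero, pow_succ, ← mul_assoc,
    ← sum_mul]
  rw [coeff_mul, coeff_mul]
  refine sum_congr rfl fun p hp => ?_
  rw [coeff_evalSeries hw F (Nat.lt_succ_of_le (HasAntidiagonal.antidiagonal.fst_le hp))]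

theorem evalSeries_one (hw : X ∣ w) : evalSeries w 1 = 1 := by
  ext N
  rw [coeff_evalSeries hw _ N.lt_succ_self, sum_range_succ']
  simp [coeff_one]

theorem evalSeries_zero (w : R⟦X⟧) : evalSeries w 0 = 0 := by
  ext N
  simp [evalSeries]

/-- Peeling off the constant term of `F` multiplies the defect of multiplicativity by `w`, so the
defect is divisible by every power of the variable. -/
theorem X_pow_dvd_evalSeries_mul_sub (hw : X ∣ w) (hc : ∀ f, Commute w f) (N : ℕ)
    (F G : R⟦X⟧⟦X⟧) : X ^ N ∣ evalSeries w (F * G) - evalSeries w F * evalSeries w G := by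
  induction N generalizing F with
  | zero => exact ⟨_, (one_mul _).symm⟩
  | succ N ih =>
    set F' : R⟦X⟧⟦X⟧ := mk fun p => coeff (p + 1) F
    have hF : F = F' * X + C (constantCoeff F) := eq_shift_mul_X_add_const F
    have hFG : F * G = F' * G * X + C (constantCoeff F) * G := by
      conv_lhs => rw [hF, add_mul, mul_assoc, ← commute_X G, ← mul_assoc]
    have hevalF : evalSeries w F = evalSeries w F' * w + constantCoeff F := by
      conv_lhs => rw [hF, evalSeries_add, evalSeries_mul_X hw, ← mul_one (C _),
        evalSeries_C_mul hw, evalSeries_one hw, mul_one]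
    have hdefect : evalSeries w (F * G) - evalSeries w F * evalSeries w G =
        (evalSeries w (F' * G) - evalSeries w F' * evalSeries w G) * w := by
      rw [hFG, evalSeries_add, evalSeries_mul_X hw, evalSeries_C_mul hw, hevalF, add_mul,
        add_sub_add_right_eq_sub, sub_mul, mul_assoc _ w, (hc _).eq, mul_assoc]
    obtain ⟨d, hd⟩ := ih F'
    obtain ⟨v, rfl⟩ := hw
    exact ⟨d * v, by rw [hdefect, hd, pow_succ, mul_assoc, ← mul_assoc d, commute_X d, mul_assoc,
      mul_assoc]⟩

/-- Evaluation at a central series without constant term. -/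
noncomputable def evalHom (w : R⟦X⟧) (hw : X ∣ w) (hc : ∀ f, Commute w f) :
    R⟦X⟧⟦X⟧ →+* R⟦X⟧ where
  toFun := evalSeries w
  map_one' := evalSeries_one hw
  map_mul' F G := by
    rw [← sub_eq_zero]
    ext N
    exact X_pow_dvd_iff.1 (X_pow_dvd_evalSeries_mul_sub hw hc (N + 1) F G) N N.lt_succ_self
  map_zero' := evalSeries_zero w
  map_add' := evalSeries_add w

end Evaluation

section Shift

variable {A : Type*} [Ring A] [Algebra ℂ A]

variable (A) in
/-- The series `(u - c)⁻¹` over `A`. -/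
noncomputable def shiftedVarIn (c : ℂ) : A⟦X⟧ :=
  PowerSeries.map (algebraMap ℂ A) (shiftedVar c)

theorem X_dvd_shiftedVarIn (c : ℂ) : X ∣ shiftedVarIn A c := by
  rw [shiftedVarIn, shiftedVar, map_mul, map_X]
  exact dvd_mul_right _ _

theorem commute_shiftedVarIn (c : ℂ) (f : A⟦X⟧) : Commute (shiftedVarIn A c) f := by
  ext N
  rw [coeff_mul, coeff_mul, ← Nat.sum_antidiagonal_swap]
  refine sum_congr rfl fun p _ => ?_
  simp [shiftedVarIn, Algebra.commutes]

theorem constantCoeff_shift (c : ℂ) (f : A⟦X⟧) :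
    constantCoeff (shift c f) = constantCoeff f := by
  rw [← coeff_zero_eq_constantCoeff_apply, shift, coeff_mk]
  simp

theorem shiftedVar_zero : shiftedVar 0 = X := by
  simpa using shiftedVar_mul 0

theorem shift_zero (f : A⟦X⟧) : shift 0 f = f := by
  ext N
  simp only [shift, coeff_mk, shiftedVar_zero, coeff_X_pow, ite_smul, one_smul, zero_smul]
  rw [sum_ite_eq, if_pos (self_mem_range_succ N)]

/-- The substitution `v ↦ (u - c)⁻¹` in a series in `v` over `A⟦u⁻¹⟧`. -/
noncomputable def evalShift (c : ℂ) : A⟦X⟧⟦X⟧ →+* A⟦X⟧ :=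
  evalHom (shiftedVarIn A c) (X_dvd_shiftedVarIn c) (commute_shiftedVarIn c)

theorem evalShift_apply (c : ℂ) (F : A⟦X⟧⟦X⟧) :
    evalShift c F = evalSeries (shiftedVarIn A c) F :=
  rfl

theorem evalShift_C (c : ℂ) (f : A⟦X⟧) : evalShift c (C f) = f := by
  rw [evalShift_apply, ← mul_one (C f), evalSeries_C_mul (X_dvd_shiftedVarIn c),
    evalSeries_one (X_dvd_shiftedVarIn c), mul_one]

theorem evalShift_X (c : ℂ) : evalShift c (X : A⟦X⟧⟦X⟧) = shiftedVarIn A c := by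
  rw [evalShift_apply, ← one_mul X, evalSeries_mul_X (X_dvd_shiftedVarIn c),
    evalSeries_one (X_dvd_shiftedVarIn c), one_mul]

theorem evalShift_map_C (c : ℂ) (f : A⟦X⟧) : evalShift c (PowerSeries.map C f) = shift c f := by
  ext N
  simp only [evalShift_apply, shift, evalSeries, coeff_mk, map_sum, coeff_map, coeff_C_mul,
    shiftedVarIn, ← map_pow]
  refine sum_congr rfl fun r _ => ?_
  rw [Algebra.smul_def, Algebra.commutes]

/-- `shift c` as a ring homomorphism. -/
noncomputable def shiftHom (c : ℂ) : A⟦X⟧ →+* A⟦X⟧ :=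
  (evalShift c).comp (PowerSeries.map C)

theorem shiftHom_apply (c : ℂ) (f : A⟦X⟧) : shiftHom c f = shift c f :=
  evalShift_map_C c f

theorem shift_C (c : ℂ) (a : A) : shift c (C a) = C a := by
  rw [← evalShift_map_C, map_C, evalShift_C]

theorem shift_X (c : ℂ) : shift c (X : A⟦X⟧) = shiftedVarIn A c := by
  rw [← evalShift_map_C, map_X, evalShift_X]

theorem shiftedVarIn_sub (a b : ℂ) :
    shiftedVarIn A b - shiftedVarIn A a = (b - a) • (shiftedVarIn A a * shiftedVarIn A b) := by
  have hne (c : ℂ) : (1 - C c * X : ℂ⟦X⟧) ≠ 0 := fun h =>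
    X_ne_zero (R := ℂ) (by rw [← shiftedVar_mul c, h, mul_zero])
  have hsub : shiftedVar b - shiftedVar a = C (b - a) * (shiftedVar a * shiftedVar b) := by
    apply mul_right_cancel₀ (mul_ne_zero (hne a) (hne b))
    rw [map_sub]
    linear_combination (1 - C a * X) * shiftedVar_mul b - (1 - C b * X) * shiftedVar_mul a
      - (C b - C a) * (shiftedVar b * (1 - C b * X)) * shiftedVar_mul a
      - (C b - C a) * X * shiftedVar_mul b
  rw [shiftedVarIn, shiftedVarIn, ← map_sub, hsub, map_mul, map_mul, map_C,
    ← PowerSeries.algebraMap_apply, Algebra.smul_def]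

theorem isUnit_of_constantCoeff_eq_one {R : Type*} [Ring R] {f : R⟦X⟧}
    (h : constantCoeff f = 1) : IsUnit f :=
  isUnit_iff_constantCoeff.2 (h ▸ isUnit_one)

theorem shiftedVarIn_mul_cancel (c : ℂ) {f g : A⟦X⟧}
    (h : shiftedVarIn A c * f = shiftedVarIn A c * g) : f = g := by
  rw [shiftedVarIn, shiftedVar, map_mul, map_X, mul_assoc, mul_assoc] at h
  refine (isUnit_of_constantCoeff_eq_one ?_).mul_right_inj.1 (X_mul_cancel h)
  rw [← coeff_zero_eq_constantCoeff_apply, coeff_map, coeff_mk, pow_zero, map_one]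

/-- The substitution `x ↦ (u - a)⁻¹`, `y ↦ (u - b)⁻¹` in series in `y` over `A⟦x⟧`. -/
noncomputable def biShift (a b : ℂ) : A⟦X⟧⟦X⟧ →+* A⟦X⟧ :=
  (evalShift b).comp (PowerSeries.map (shiftHom a))

theorem biShift_C (a b : ℂ) (f : A⟦X⟧) : biShift a b (C f) = shift a f := by
  rw [biShift, RingHom.comp_apply, map_C, evalShift_C, shiftHom_apply]

theorem biShift_X (a b : ℂ) : biShift a b (X : A⟦X⟧⟦X⟧) = shiftedVarIn A b := by
  rw [biShift, RingHom.comp_apply, map_X, evalShift_X]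

theorem biShift_map_C (a b : ℂ) (f : A⟦X⟧) : biShift a b (PowerSeries.map C f) = shift b f := by
  rw [biShift, RingHom.comp_apply, ← evalShift_map_C b f]
  congr 1
  ext1 N
  rw [coeff_map, coeff_map, shiftHom_apply, shift_C]

theorem exists_polynomial_coeff_shiftedVar_pow (N r : ℕ) :
    ∃ q : Polynomial ℂ, ∀ c, coeff N (shiftedVar c ^ r) = q.eval c := by
  let W : (Polynomial ℂ)⟦X⟧ := X * PowerSeries.mk fun k => Polynomial.X ^ k
  have hW (c : ℂ) : PowerSeries.map (Polynomial.evalRingHom c) W = shiftedVar c := by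
    rw [map_mul, map_X, shiftedVar]
    congr 1
    ext k
    simp
  refine ⟨coeff N (W ^ r), fun c => ?_⟩
  rw [← hW, ← map_pow, coeff_map, Polynomial.coe_evalRingHom]

/-- Linear functionals turn each coefficient of `F((u - c)⁻¹)` into a polynomial in `c`. -/
theorem evalShift_eq_zero_of_infinite {F : A⟦X⟧⟦X⟧} {s : Set ℂ} (hs : s.Infinite)
    (h : ∀ c ∈ s, evalShift c F = 0) (c : ℂ) : evalShift c F = 0 := by
  ext N
  rw [map_zero, ← Module.forall_dual_apply_eq_zero_iff ℂ]
  intro ℓ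
  choose q hq using exists_polynomial_coeff_shiftedVar_pow
  let p : Polynomial ℂ := ∑ r ∈ range (N + 1), ∑ x ∈ HasAntidiagonal.antidiagonal N,
    Polynomial.C (ℓ (coeff x.1 (coeff r F))) * q x.2 r
  have hp (c : ℂ) : ℓ (coeff N (evalShift c F)) = p.eval c := by
    simp only [p, evalShift_apply, evalSeries, coeff_mk, map_sum, coeff_mul, shiftedVarIn,
      ← map_pow, coeff_map, hq, Polynomial.eval_finsetSum, Polynomial.eval_mul,
      Polynomial.eval_C, ← Algebra.commutes, ← Algebra.smul_def, map_smul, smul_eq_mul, mul_comm]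
  have hp_zero : p = 0 := Polynomial.eq_zero_of_infinite_isRoot p <| hs.mono fun c hc => by
    rw [Set.mem_ofPred_eq, Polynomial.IsRoot, ← hp, h c hc, map_zero, map_zero]
  rw [hp, hp_zero, Polynomial.eval_zero]

theorem commute_shift_of_infinite {f g : A⟦X⟧} {s : Set ℂ} (hs : s.Infinite)
    (h : ∀ c ∈ s, Commute (shift c f) g) (c : ℂ) : Commute (shift c f) g := by
  have heval (c : ℂ) : evalShift c (PowerSeries.map C f * C g - C g * PowerSeries.map C f) =
      shift c f * g - g * shift c f := by
    rw [map_sub, map_mul, map_mul, evalShift_C, evalShift_map_C]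
  have hzero := evalShift_eq_zero_of_infinite hs
    (fun c hc => by rw [heval, sub_eq_zero]; exact h c hc) c
  rwa [heval, sub_eq_zero] at hzero

end Shift

section Relations

variable {A : Type*} [Ring A] {κ : Type*} [DecidableEq κ]

/-- A matrix of series `S(u) = 1 + ⋯` whose coefficients satisfy the defining relations of the
Yangian. The case to keep in mind is a submatrix of `T(u)`. -/
structure IsYangianMatrix (S : Matrix κ κ A⟦X⟧) : Prop where
  constantCoeff_eq : ∀ i j, constantCoeff (S i j) = if i = j then 1 else 0
  coeff_comm : ∀ i j k l r s,
    coeff (r + 1) (S i j) * coeff s (S k l) - coeff s (S k l) * coeff (r + 1) (S i j) -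
        (coeff r (S i j) * coeff (s + 1) (S k l) - coeff (s + 1) (S k l) * coeff r (S i j)) =
      coeff r (S k j) * coeff s (S i l) - coeff s (S k j) * coeff r (S i l)

theorem t_zero (n : ℕ) (i j : Fin n) : t n i j 0 = if i = j then 1 else 0 := by
  rw [t, freeT, apply_ite (RingQuot.mkAlgHom ℂ (Rel n)), map_one, map_zero]

theorem t_rel (n : ℕ) (i j k l : Fin n) (r s : ℕ) :
    t n i j (r + 1) * t n k l s - t n k l s * t n i j (r + 1) -
        (t n i j r * t n k l (s + 1) - t n k l (s + 1) * t n i j r) =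
      t n k j r * t n i l s - t n k j s * t n i l r := by
  have h := RingQuot.mkAlgHom_rel ℂ (Rel.defining i j k l r s)
  simp only [map_sub, map_mul] at h
  exact h

theorem isYangianMatrix_T (n : ℕ) : IsYangianMatrix (T n) where
  constantCoeff_eq i j := by
    rw [← coeff_zero_eq_constantCoeff_apply, T, Matrix.of_apply, coeff_mk, t_zero]
  coeff_comm i j k l r s := by
    simp only [T, Matrix.of_apply, coeff_mk, t_rel]

namespace IsYangianMatrix

variable {S : Matrix κ κ A⟦X⟧}

theorem submatrix (hS : IsYangianMatrix S) {κ' : Type*} [DecidableEq κ'] {e : κ' → κ}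
    (he : Function.Injective e) : IsYangianMatrix (S.submatrix e e) where
  constantCoeff_eq i j := by simp [hS.constantCoeff_eq, he.eq_iff]
  coeff_comm i j k l r s := hS.coeff_comm _ _ _ _ r s

/-- With `x = u⁻¹` and `y = v⁻¹` this is
`(u - v) [s_{ij}(u), s_{kl}(v)] = s_{kj}(u) s_{il}(v) - s_{kj}(v) s_{il}(u)` multiplied by `xy`. -/
theorem formal_comm (hS : IsYangianMatrix S) (i j k l : κ) :
    (X - C X) * (C (S i j) * PowerSeries.map C (S k l) - PowerSeries.map C (S k l) * C (S i j)) =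
      C X * (X * (C (S k j) * PowerSeries.map C (S i l) -
        PowerSeries.map C (S k j) * C (S i l))) := by
  have hconst (i j) : coeff 0 (S i j) = if i = j then 1 else 0 := by
    rw [coeff_zero_eq_constantCoeff_apply, hS.constantCoeff_eq]
  ext s r
  rcases s with _ | s <;> rcases r with _ | r
  all_goals simp only [sub_mul, map_sub, coeff_C_mul, coeff_mul_C, coeff_succ_X_mul,
    coeff_zero_X_mul, coeff_map]
  · simp
  · simp only [hconst]
    split_ifs <;> simp
  · simp only [hconst]
    split_ifs <;> simp
  · exact hS.coeff_comm i j k l r s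

theorem shift_comm [Algebra ℂ A] (hS : IsYangianMatrix S) (i j k l : κ) (a b : ℂ) :
    (b - a) • (shift a (S i j) * shift b (S k l) - shift b (S k l) * shift a (S i j)) =
      shift a (S k j) * shift b (S i l) - shift b (S k j) * shift a (S i l) := by
  have h := congrArg (biShift a b) (hS.formal_comm i j k l)
  simp only [map_sub, map_mul, biShift_X, biShift_C, biShift_map_C, shift_X] at h
  rw [shiftedVarIn_sub, smul_mul_assoc, ← mul_smul_comm, mul_assoc] at h
  exact shiftedVarIn_mul_cancel b (shiftedVarIn_mul_cancel a h)

end IsYangianMatrix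

end Relations

section Antisymmetrizer

open Equiv

variable {ι B : Type*} [DecidableEq ι] [Ring B]

/-- The sum of the transpositions `(a b)` over `b ∈ s`, in a representation `ρ` of the symmetric
group. -/
def starSum (ρ : Perm ι →* B) (a : ι) (s : Finset ι) : B :=
  ∑ b ∈ s, ρ (swap a b)

theorem swap_apply_of_notMem {s : Finset ι} {b c d : ι} (hb : b ∈ s) (hc : c ∈ s)
    (hd : d ∉ s) : swap b c d = d :=
  swap_apply_of_ne_of_ne (fun h => hd (h ▸ hb)) fun h => hd (h ▸ hc)

variable [Fintype ι]

/-- The antisymmetrizer over the permutations supported in `s`, in a representation `ρ` of the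
symmetric group. -/
def partialAntisymmetrizer (ρ : Perm ι →* B) (s : Finset ι) : B :=
  ∑ σ : Perm ι with ∀ a ∉ s, σ a = a, Perm.sign σ • ρ σ

variable {ρ : Perm ι →* B} {s : Finset ι}

theorem apply_mul_partialAntisymmetrizer {σ : Perm ι} (hσ : ∀ a ∉ s, σ a = a) :
    ρ σ * partialAntisymmetrizer ρ s = Perm.sign σ • partialAntisymmetrizer ρ s := by
  rw [partialAntisymmetrizer, mul_sum, smul_sum]
  refine sum_equiv (Equiv.mulLeft σ) (fun τ => ?_) fun τ _ => ?_
  · simp only [mem_filter_univ, coe_mulLeft, Perm.mul_apply]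
    refine forall₂_congr fun a ha => ?_
    rw [← σ.eq_symm_apply, σ.symm_apply_eq.2 (hσ a ha).symm]
  · rw [coe_mulLeft, map_mul, map_mul, smul_smul, mul_smul_comm, ← mul_assoc, Int.units_mul_self,
      one_mul]

theorem partialAntisymmetrizer_mul_apply {σ : Perm ι} (hσ : ∀ a ∉ s, σ a = a) :
    partialAntisymmetrizer ρ s * ρ σ = Perm.sign σ • partialAntisymmetrizer ρ s := by
  rw [partialAntisymmetrizer, sum_mul, smul_sum]
  refine sum_equiv (Equiv.mulRight σ) (fun τ => ?_) fun τ _ => ?_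
  · simp only [mem_filter_univ, coe_mulRight, Perm.mul_apply]
    refine forall₂_congr fun a ha => by rw [hσ a ha]
  · rw [coe_mulRight, map_mul, map_mul, smul_smul, smul_mul_assoc, mul_comm, mul_assoc,
      Int.units_mul_self, mul_one]

theorem partialAntisymmetrizer_mul_swap {b c : ι} (hb : b ∈ s) (hc : c ∈ s) (hbc : b ≠ c) :
    partialAntisymmetrizer ρ s * ρ (swap b c) = -partialAntisymmetrizer ρ s := by
  rw [partialAntisymmetrizer_mul_apply fun _ => swap_apply_of_notMem hb hc,
    Perm.sign_swap hbc, Units.neg_smul, one_smul]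

theorem commute_partialAntisymmetrizer {y : B}
    (h : ∀ σ : Perm ι, (∀ a ∉ s, σ a = a) → Commute (ρ σ) y) :
    Commute (partialAntisymmetrizer ρ s) y :=
  Commute.sum_left _ _ _ fun σ hσ => (h σ (by simpa using hσ)).smul_left _

theorem partialAntisymmetrizer_empty : partialAntisymmetrizer ρ ∅ = 1 := by
  have : ({σ : Perm ι | ∀ a ∉ (∅ : Finset ι), σ a = a} : Finset (Perm ι)) = {1} := by
    ext σ
    simp [Perm.ext_iff]
  rw [partialAntisymmetrizer, this, sum_singleton, Perm.sign_one, one_smul, map_one]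

theorem partialAntisymmetrizer_insert_eq_sum {a : ι} (ha : a ∉ s) :
    partialAntisymmetrizer ρ (insert a s) =
      ∑ b ∈ insert a s, ∑ τ : Perm ι with ∀ d ∉ s, τ d = d,
        Perm.sign (τ * swap a b) • ρ (τ * swap a b) := by
  rw [partialAntisymmetrizer, sum_sigma']
  refine sum_nbij' (fun σ => ⟨σ.symm a, σ * swap a (σ.symm a)⟩) (fun p => p.2 * swap a p.1)
    (fun σ hσ => ?_) (fun p hp => ?_) (fun σ _ => ?_) (fun p hp => ?_) fun σ _ => ?_
  · simp only [mem_filter_univ, mem_sigma, Perm.mul_apply] at hσ ⊢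
    have hmem : σ.symm a ∈ insert a s := by
      by_contra hb
      have hfix := hσ _ hb
      rw [σ.apply_symm_apply] at hfix
      exact hb (hfix ▸ mem_insert_self a s)
    refine ⟨hmem, fun d hd => ?_⟩
    by_cases hda : d = a
    · rw [hda, swap_apply_left, σ.apply_symm_apply]
    · have hd' : d ∉ insert a s := by simp [hda, hd]
      rw [swap_apply_of_notMem (mem_insert_self a s) hmem hd', hσ d hd']
  · simp only [mem_filter_univ, mem_sigma, Perm.mul_apply] at hp ⊢
    intro d hd
    rw [swap_apply_of_notMem (mem_insert_self a s) hp.1 hd,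
      hp.2 d fun h => hd (mem_insert_of_mem h)]
  · simp [mul_assoc]
  · simp only [mem_filter_univ, mem_sigma] at hp
    have hsymm : (p.2 * swap a p.1).symm a = p.1 := by
      rw [symm_apply_eq, Perm.mul_apply, swap_apply_right, hp.2 a ha]
    simp [hsymm, mul_assoc]
  · simp [mul_assoc]

theorem partialAntisymmetrizer_insert {a : ι} (ha : a ∉ s) :
    partialAntisymmetrizer ρ (insert a s) =
      partialAntisymmetrizer ρ s * (1 - starSum ρ a s) := by
  have hterm (b : ι) (hb : b ∈ s) : ∑ τ : Perm ι with ∀ d ∉ s, τ d = d,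
      Perm.sign (τ * swap a b) • ρ (τ * swap a b) =
        -(partialAntisymmetrizer ρ s * ρ (swap a b)) := by
    rw [partialAntisymmetrizer, sum_mul, ← sum_neg_distrib]
    refine sum_congr rfl fun τ _ => ?_
    rw [map_mul, map_mul, Perm.sign_swap (ne_of_mem_of_not_mem hb ha).symm, mul_neg_one,
      Units.neg_smul, smul_mul_assoc]
  rw [partialAntisymmetrizer_insert_eq_sum ha, sum_insert ha, sum_congr rfl hterm, sum_neg_distrib,
    ← mul_sum, mul_sub, mul_one, starSum, sub_eq_add_neg]
  simp only [swap_self, ← Perm.one_def, mul_one, partialAntisymmetrizer]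

end Antisymmetrizer

section Fusion

open Equiv

variable {ι K B : Type*} [DecidableEq ι] [Field K] [Ring B] [Algebra K B]

/-- The `R`-matrix `R_{ab}(u_a - u_b) = (u_a - u_b) - P_{ab}` for the spectral parameters
`u_a = u - c a`. -/
def rMatrix (ρ : Perm ι →* B) (c : ι → K) (a b : ι) : B :=
  (c b - c a) • 1 - ρ (swap a b)

/-- A family of elements `X a`, to be thought of as `T_a(u - c a)`, satisfying the `RTT` relation
`R_{ab} X_a X_b = X_b X_a R_{ab}` in a representation `ρ` of the symmetric group. -/
structure IsRTTFamily (ρ : Perm ι →* B) (c : ι → K) (X : ι → B) : Prop where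
  commute_of_fixed : ∀ {σ : Perm ι} {a : ι}, σ a = a → Commute (ρ σ) (X a)
  rMatrix_mul : ∀ {a b : ι}, a ≠ b →
    rMatrix ρ c a b * (X a * X b) = X b * X a * rMatrix ρ c a b

/-- The product `R_{a b_k} ⋯ R_{a b_1}` over a list `b_1, …, b_k`. -/
def rProd (ρ : Perm ι →* B) (c : ι → K) (a : ι) (l : List ι) : B :=
  (l.reverse.map (rMatrix ρ c a)).prod

variable {ρ : Perm ι →* B} {c : ι → K} {X : ι → B}

theorem rProd_cons (a b : ι) (l : List ι) :
    rProd ρ c a (b :: l) = rProd ρ c a l * rMatrix ρ c a b := by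
  simp [rProd]

theorem starSum_insert {a b : ι} {s : Finset ι} (hb : b ∉ s) :
    starSum ρ a (insert b s) = ρ (swap a b) + starSum ρ a s :=
  sum_insert hb

theorem mul_starSum_mul_swap {y : B} {a b : ι} {s : Finset ι} (hb : b ∉ s)
    (hab : a ≠ b) (hy : ∀ d ∈ s, y * ρ (swap d b) = -y) :
    y * starSum ρ a s * ρ (swap a b) = -(y * starSum ρ a s) := by
  rw [starSum, mul_sum, sum_mul, ← sum_neg_distrib]
  refine sum_congr rfl fun d hd => ?_
  rw [mul_assoc, ← map_mul, mul_swap_eq_swap_mul, swap_apply_left,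
    swap_apply_of_ne_of_ne hab.symm (ne_of_mem_of_not_mem hd hb).symm, map_mul, ← mul_assoc,
    hy d hd, neg_mul]

/-- The spectral parameters along the list being consecutive, the product of `R`-matrices
telescopes on anti-invariant elements. -/
theorem mul_rProd_cons {y : B} {a b : ι} {l : List ι} (hl : (a :: b :: l).Nodup)
    (hc : (b :: l).IsChain fun i j => c j = c i + 1)
    (hy : ∀ d ∈ b :: l, ∀ e ∈ b :: l, d ≠ e → y * ρ (swap d e) = -y) :
    y * rProd ρ c a (b :: l) = (l.map fun j => c j - c a).prod •
      (y * ((c b - c a) • 1 - starSum ρ a (b :: l).toFinset)) := by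
  induction l generalizing b with
  | nil => simp [rProd, rMatrix, starSum]
  | cons b' l ih =>
    obtain ⟨⟨hab, ha⟩, hb, hl⟩ : (a ≠ b ∧ a ∉ b' :: l) ∧ b ∉ b' :: l ∧ (b' :: l).Nodup := by
      rwa [List.nodup_cons, List.nodup_cons, List.mem_cons, not_or] at hl
    obtain ⟨hbb', hc⟩ := List.isChain_cons_cons.1 hc
    have hstar : y * starSum ρ a (b' :: l).toFinset * ρ (swap a b) =
        -(y * starSum ρ a (b' :: l).toFinset) :=
      mul_starSum_mul_swap (by simpa using hb) hab fun d hd => by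
        rw [List.mem_toFinset] at hd
        exact hy d (List.mem_cons_of_mem _ hd) b List.mem_cons_self (ne_of_mem_of_not_mem hd hb)
    rw [rProd_cons, ← mul_assoc, ih (List.nodup_cons.2 ⟨ha, hl⟩) hc fun d hd e he =>
      hy d (List.mem_cons_of_mem _ hd) e (List.mem_cons_of_mem _ he), List.toFinset_cons (a := b),
      starSum_insert (by simpa using hb), List.map_cons, List.prod_cons, hbb', rMatrix]
    simp only [mul_sub, mul_add, sub_mul, smul_mul_assoc, mul_smul_comm, mul_one, hstar]
    module

namespace IsRTTFamily

variable (hX : IsRTTFamily ρ c X)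
include hX

theorem commute_list_prod {σ : Perm ι} {l : List ι} (hσ : ∀ a ∈ l, σ a = a) :
    Commute (ρ σ) (l.map X).prod :=
  Commute.list_prod_right _ _ fun x hx => by
    obtain ⟨a, ha, rfl⟩ := List.mem_map.1 hx
    exact hX.commute_of_fixed (hσ a ha)

theorem commute_rProd {a b : ι} {l : List ι} (hab : b ≠ a) (hb : b ∉ l) :
    Commute (rProd ρ c a l) (X b) :=
  Commute.list_prod_left _ _ fun x hx => by
    obtain ⟨d, hd, rfl⟩ := List.mem_map.1 hx
    exact ((Commute.one_left _).smul_left _).sub_left (hX.commute_of_fixed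
      (swap_apply_of_ne_of_ne hab (ne_of_mem_of_not_mem (List.mem_reverse.1 hd) hb).symm))

theorem rProd_mul {a : ι} {l : List ι} (hl : (a :: l).Nodup) :
    rProd ρ c a l * (X a * (l.map X).prod) = (l.map X).prod * X a * rProd ρ c a l := by
  induction l with
  | nil => simp [rProd]
  | cons b l ih =>
    simp only [List.nodup_cons, List.mem_cons, not_or] at hl
    obtain ⟨⟨hab, ha⟩, hb, hl⟩ := hl
    have hcomm : Commute (rMatrix ρ c a b) (l.map X).prod :=
      ((Commute.one_left _).smul_left _).sub_left (hX.commute_list_prod fun d hd =>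
        swap_apply_of_ne_of_ne (ne_of_mem_of_not_mem hd ha) (ne_of_mem_of_not_mem hd hb))
    rw [rProd_cons, List.map_cons, List.prod_cons]
    calc rProd ρ c a l * rMatrix ρ c a b * (X a * (X b * (l.map X).prod))
        = rProd ρ c a l * (rMatrix ρ c a b * (X a * X b)) * (l.map X).prod := by
          simp only [mul_assoc]
      _ = rProd ρ c a l * X b * X a * (rMatrix ρ c a b * (l.map X).prod) := by
          rw [hX.rMatrix_mul hab]
          simp only [mul_assoc]
      _ = X b * (rProd ρ c a l * (X a * (l.map X).prod)) * rMatrix ρ c a b := by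
          rw [hcomm.eq, (hX.commute_rProd (Ne.symm hab) hb).eq]
          simp only [mul_assoc]
      _ = X b * (l.map X).prod * X a * (rProd ρ c a l * rMatrix ρ c a b) := by
          rw [ih (List.nodup_cons.2 ⟨ha, hl⟩)]
          simp only [mul_assoc]

variable [Fintype ι]

theorem commute_partialAntisymmetrizer_apply {a : ι} {s : Finset ι} (ha : a ∉ s) :
    Commute (partialAntisymmetrizer ρ s) (X a) :=
  commute_partialAntisymmetrizer fun _ hσ => hX.commute_of_fixed (hσ a ha)

theorem partialAntisymmetrizer_mul_smul_sub_starSum_mul {a b : ι} {l : List ι}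
    (hl : (a :: b :: l).Nodup)
    (hc : (b :: l).IsChain fun i j => c j = c i + 1) (hca : ∀ j ∈ l, c j ≠ c a)
    (h : partialAntisymmetrizer ρ (b :: l).toFinset * ((b :: l).map X).prod =
      ((b :: l).reverse.map X).prod * partialAntisymmetrizer ρ (b :: l).toFinset) :
    partialAntisymmetrizer ρ (b :: l).toFinset *
          ((c b - c a) • 1 - starSum ρ a (b :: l).toFinset) * (X a * ((b :: l).map X).prod) =
      ((b :: l).reverse.map X).prod * X a * (partialAntisymmetrizer ρ (b :: l).toFinset *
        ((c b - c a) • 1 - starSum ρ a (b :: l).toFinset)) := by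
  have hq : (l.map fun j => c j - c a).prod ≠ 0 := by
    simpa [List.prod_eq_zero_iff, sub_eq_zero] using hca
  have hprod := mul_rProd_cons (ρ := ρ) (y := partialAntisymmetrizer ρ (b :: l).toFinset) hl hc
    fun d hd e he => partialAntisymmetrizer_mul_swap (List.mem_toFinset.2 hd)
      (List.mem_toFinset.2 he)
  have hcomm : Commute (partialAntisymmetrizer ρ (b :: l).toFinset) (X a) :=
    hX.commute_partialAntisymmetrizer_apply (by simpa using (List.nodup_cons.1 hl).1)
  refine smul_right_injective B hq ?_
  simp only
  rw [← smul_mul_assoc, ← mul_smul_comm _ (((b :: l).reverse.map X).prod * X a), ← hprod,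
    mul_assoc, hX.rProd_mul hl]
  simp only [← mul_assoc]
  rw [h, mul_assoc _ (partialAntisymmetrizer ρ _), hcomm.eq]
  simp only [← mul_assoc]

theorem partialAntisymmetrizer_mul_prod {l : List ι} (hl : l.Nodup)
    (hc : l.IsChain fun i j => c j = c i + 1) (hinj : Set.InjOn c {a | a ∈ l}) :
    partialAntisymmetrizer ρ l.toFinset * (l.map X).prod =
      (l.reverse.map X).prod * partialAntisymmetrizer ρ l.toFinset := by
  induction l with
  | nil => simp
  | cons a l ih =>
    have ha : a ∉ l.toFinset := by simpa using (List.nodup_cons.1 hl).1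
    have ih := ih hl.of_cons hc.tail (hinj.mono fun _ => List.mem_cons_of_mem a)
    rw [List.toFinset_cons, partialAntisymmetrizer_insert ha]
    rcases l with _ | ⟨b, l⟩
    · simp [partialAntisymmetrizer_empty, starSum]
    · have hgap : c b - c a = 1 := by rw [(List.isChain_cons_cons.1 hc).1, add_sub_cancel_left]
      have hne : ∀ j ∈ l, c j ≠ c a := fun j hj h => (List.nodup_cons.1 hl).1 <|
        hinj (by simp [hj]) List.mem_cons_self h ▸ List.mem_cons_of_mem b hj
      have := hX.partialAntisymmetrizer_mul_smul_sub_starSum_mul hl hc.tail hne ih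
      rw [hgap, one_smul] at this
      simpa [mul_assoc] using this

/-- If the antisymmetrizer on one more index `a` vanishes, `1 - starSum` acts on the antisymmetrizer
of `l` as a scalar, and the fusion identity becomes the commutation of `X a`. -/
theorem commute_of_partialAntisymmetrizer_insert_eq_zero {a b : ι} {l : List ι}
    (hl : (a :: b :: l).Nodup) (hc : (b :: l).IsChain fun i j => c j = c i + 1)
    (hinj : Set.InjOn c {a | a ∈ b :: l}) (hca : ∀ j ∈ l, c j ≠ c a) (hgap : c b ≠ c a + 1)
    (hzero : partialAntisymmetrizer ρ (insert a (b :: l).toFinset) = 0) :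
    Commute (X a) (partialAntisymmetrizer ρ (b :: l).toFinset * ((b :: l).map X).prod) := by
  have ha : a ∉ (b :: l).toFinset := by simpa using (List.nodup_cons.1 hl).1
  have h := hX.partialAntisymmetrizer_mul_prod hl.of_cons hc hinj
  have hfusion := hX.partialAntisymmetrizer_mul_smul_sub_starSum_mul hl hc hca h
  have hscalar : partialAntisymmetrizer ρ (b :: l).toFinset *
      ((c b - c a) • 1 - starSum ρ a (b :: l).toFinset) =
        (c b - c a - 1) • partialAntisymmetrizer ρ (b :: l).toFinset := by
    rw [partialAntisymmetrizer_insert ha, mul_sub, mul_one, sub_eq_zero] at hzero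
    rw [mul_sub, ← hzero, mul_smul_comm, mul_one, sub_smul _ (1 : K), one_smul]
  have hcomm := (hX.commute_partialAntisymmetrizer_apply ha).eq
  rw [hscalar, smul_mul_assoc, mul_smul_comm] at hfusion
  have hfusion := smul_right_injective B
    (show c b - c a - 1 ≠ 0 by rwa [sub_sub, sub_ne_zero]) hfusion
  rw [commute_iff_eq, ← mul_assoc, ← hcomm, mul_assoc, hfusion, mul_assoc, ← hcomm, ← mul_assoc, h]

end IsRTTFamily

end Fusion

section TensorSpace

open Equiv

variable {R : Type*} [Ring R] {n N : ℕ}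

variable (R n N) in
/-- The action of permutations on `(Rⁿ)^{⊗N}` by permuting the tensor factors. -/
def tensorPerm : Perm (Fin N) →* Matrix (Fin N → Fin n) (Fin N → Fin n) R where
  toFun σ := Matrix.of fun I J => if I ∘ σ = J then 1 else 0
  map_one' := by
    ext I J
    simp [Matrix.one_apply]
  map_mul' σ τ := by
    ext I J
    simp only [Matrix.mul_apply, Matrix.of_apply, ite_mul, one_mul, zero_mul, sum_ite_eq, mem_univ,
      if_true]
    rfl

theorem tensorPerm_apply (σ : Perm (Fin N)) (I J : Fin N → Fin n) :
    tensorPerm R n N σ I J = if I ∘ σ = J then 1 else 0 :=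
  rfl

theorem tensorPerm_mul_apply (σ : Perm (Fin N)) (M : Matrix (Fin N → Fin n) (Fin N → Fin n) R)
    (I J : Fin N → Fin n) : (tensorPerm R n N σ * M) I J = M (I ∘ σ) J := by
  simp [Matrix.mul_apply, tensorPerm_apply]

theorem mul_tensorPerm_apply (σ : Perm (Fin N)) (M : Matrix (Fin N → Fin n) (Fin N → Fin n) R)
    (I J : Fin N → Fin n) : (M * tensorPerm R n N σ) I J = M I (J ∘ σ.symm) := by
  simp [Matrix.mul_apply, tensorPerm_apply, ← Equiv.eq_comp_symm]

theorem antisymmetrizer_eq_partialAntisymmetrizer (R : Type*) [Ring R] (n m : ℕ) :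
    antisymmetrizer R n m = partialAntisymmetrizer (tensorPerm R n m) univ := by
  ext I J
  rw [antisymmetrizer, Matrix.of_apply, ← Equiv.sum_comp (Equiv.inv (Perm (Fin m))),
    partialAntisymmetrizer, Matrix.sum_apply]
  simp [tensorPerm_apply, Equiv.eq_comp_symm, Units.smul_def]

theorem onCopy_mul_apply (Z : Matrix (Fin n) (Fin n) R) (a : Fin N)
    (M : Matrix (Fin N → Fin n) (Fin N → Fin n) R) (I J : Fin N → Fin n) :
    (onCopy N Z a * M) I J = ∑ k, Z (I a) k * M (Function.update I a k) J := by
  rw [Matrix.mul_apply]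
  symm
  refine sum_of_injOn (fun k => Function.update I a k) (Function.update_injective I a).injOn
    (fun _ _ => mem_coe.2 (mem_univ _)) (fun K _ hK => ?_) fun k _ => ?_
  · rw [onCopy, Matrix.of_apply, if_neg, zero_mul]
    exact fun h => hK ⟨K a, mem_coe.2 (mem_univ _), Function.update_eq_iff.2 ⟨rfl, h⟩⟩
  · rw [onCopy, Matrix.of_apply, if_pos, Function.update_self]
    exact fun b hb => by rw [Function.update_of_ne hb]

theorem mul_onCopy_apply (Z : Matrix (Fin n) (Fin n) R) (a : Fin N)
    (M : Matrix (Fin N → Fin n) (Fin N → Fin n) R) (I J : Fin N → Fin n) :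
    (M * onCopy N Z a) I J = ∑ k, M I (Function.update J a k) * Z k (J a) := by
  rw [Matrix.mul_apply]
  symm
  refine sum_of_injOn (fun k => Function.update J a k) (Function.update_injective J a).injOn
    (fun _ _ => mem_coe.2 (mem_univ _)) (fun K _ hK => ?_) fun k _ => ?_
  · rw [onCopy, Matrix.of_apply, if_neg, mul_zero]
    exact fun h => hK ⟨K a, mem_coe.2 (mem_univ _),
      Function.update_eq_iff.2 ⟨rfl, fun b hb => (h b hb).symm⟩⟩
  · rw [onCopy, Matrix.of_apply, if_pos, Function.update_self]
    exact fun b hb => by rw [Function.update_of_ne hb]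

theorem onCopy_list_prod_apply (Z : Fin N → Matrix (Fin n) (Fin n) R) {l : List (Fin N)}
    (hl : l.Nodup) (I J : Fin N → Fin n) :
    (l.map fun a => onCopy N (Z a) a).prod I J =
      if ∀ b ∉ l, I b = J b then (l.map fun a => Z a (I a) (J a)).prod else 0 := by
  induction l generalizing I with
  | nil => simp [Matrix.one_apply, funext_iff]
  | cons a l ih =>
    obtain ⟨ha, hl⟩ := List.nodup_cons.1 hl
    have hne {b : Fin N} (hb : b ∈ l) : b ≠ a := ne_of_mem_of_not_mem hb ha
    rw [List.map_cons, List.prod_cons, onCopy_mul_apply, sum_eq_single (J a)]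
    · have hcond : (∀ b ∉ l, Function.update I a (J a) b = J b) ↔ ∀ b ∉ a :: l, I b = J b := by
        refine forall_congr' fun b => ?_
        by_cases hba : b = a
        · simp [hba]
        · simp [hba]
      rw [ih hl, if_congr hcond rfl rfl, mul_ite, mul_zero, List.map_cons, List.prod_cons]
      refine if_congr Iff.rfl ?_ rfl
      congr 2
      exact List.map_congr_left fun b hb => by rw [Function.update_of_ne (hne hb)]
    · intro k _ hk
      rw [ih hl, if_neg, mul_zero]
      exact fun h => hk (by simpa using h a ha)
    · simp

theorem onCopy_mul_onCopy_apply (Z W : Matrix (Fin n) (Fin n) R) {a b : Fin N} (hab : a ≠ b)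
    (I J : Fin N → Fin n) :
    (onCopy N Z a * onCopy N W b) I J =
      if ∀ d, d ≠ a → d ≠ b → I d = J d then Z (I a) (J a) * W (I b) (J b) else 0 := by
  have h := onCopy_list_prod_apply (fun d => if d = a then Z else W)
    (show [a, b].Nodup by simpa using hab) I J
  simpa [hab.symm] using h

theorem commute_tensorPerm_onCopy (Z : Matrix (Fin n) (Fin n) R) {σ : Perm (Fin N)} {a : Fin N}
    (hσ : σ a = a) : Commute (tensorPerm R n N σ) (onCopy N Z a) := by
  ext I J
  rw [tensorPerm_mul_apply, mul_tensorPerm_apply]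
  have hσ' : σ.symm a = a := σ.symm_apply_eq.2 hσ.symm
  simp only [onCopy, Matrix.of_apply, Function.comp_apply, hσ, hσ']
  refine if_congr (σ.forall_congr fun b => ?_) rfl rfl
  rw [σ.symm_apply_apply, ne_eq, ne_eq, σ.injective.eq_iff' hσ]

theorem onCopy_rtt {K : Type*} [CommRing K] [Algebra K R] {Z W : Matrix (Fin n) (Fin n) R}
    {x : K}
    (h : ∀ i j k l, x • (Z i j * W k l - W k l * Z i j) = Z k j * W i l - W k j * Z i l)
    {a b : Fin N} (hab : a ≠ b) :
    (x • 1 - tensorPerm R n N (swap a b)) * (onCopy N Z a * onCopy N W b) =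
      onCopy N W b * onCopy N Z a * (x • 1 - tensorPerm R n N (swap a b)) := by
  ext I J
  simp only [sub_mul, mul_sub, smul_mul_assoc, mul_smul_comm, one_mul, mul_one, Matrix.sub_apply,
    Matrix.smul_apply, tensorPerm_mul_apply, mul_tensorPerm_apply, symm_swap,
    onCopy_mul_onCopy_apply _ _ hab, onCopy_mul_onCopy_apply _ _ hab.symm, Function.comp_apply,
    swap_apply_left, swap_apply_right]
  have hleft : (∀ d, d ≠ a → d ≠ b → I (swap a b d) = J d) ↔ ∀ d, d ≠ a → d ≠ b → I d = J d :=
    forall_congr' fun d => forall₂_congr fun ha hb => by rw [swap_apply_of_ne_of_ne ha hb]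
  have hright : (∀ d, d ≠ b → d ≠ a → I d = J (swap a b d)) ↔ ∀ d, d ≠ a → d ≠ b → I d = J d :=
    forall_congr' fun d => forall_comm.trans <| forall₂_congr fun ha hb => by
      rw [swap_apply_of_ne_of_ne ha hb]
  have hcomm : (∀ d, d ≠ b → d ≠ a → I d = J d) ↔ ∀ d, d ≠ a → d ≠ b → I d = J d :=
    forall_congr' fun d => forall_comm
  simp only [hleft, hright, hcomm]
  split_ifs
  · have hrel := h (I a) (J a) (I b) (J b)
    rw [smul_sub, sub_eq_sub_iff_add_eq_add] at hrel
    rw [sub_eq_sub_iff_add_eq_add, hrel, add_comm]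
  · simp

end TensorSpace

section Alternating

open Equiv

variable {ι κ V : Type*} [Fintype ι] [DecidableEq ι] [AddCommGroup V]

/-- Antisymmetry of a function of a multi-index under permutations of the positions. -/
def IsAlternating (f : (ι → κ) → V) : Prop :=
  ∀ (σ : Perm ι) (I : ι → κ), f (I ∘ σ) = Perm.sign σ • f I

variable [IsAddTorsionFree V]

theorem IsAlternating.eq_zero_of_not_injective {f : (ι → κ) → V} (hf : IsAlternating f)
    {I : ι → κ} (hI : ¬ Function.Injective I) : f I = 0 := by
  obtain ⟨b, c, hbc, hne⟩ : ∃ b c, I b = I c ∧ b ≠ c := by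
    simpa [Function.Injective] using hI
  have hswap : I ∘ swap b c = I := by
    rw [Equiv.comp_swap_eq_update, hbc, Function.update_eq_self, ← hbc, Function.update_eq_self]
  have h := hf (swap b c) I
  rw [hswap, Perm.sign_swap hne, Units.neg_smul, one_smul] at h
  exact self_eq_neg.1 h

theorem IsAlternating.ext {f g : (ι → ι) → V} (hf : IsAlternating f) (hg : IsAlternating g)
    (h : f id = g id) : f = g := by
  funext I
  by_cases hI : Function.Injective I
  · have hf_I := hf (Equiv.ofBijective I hI.bijective_of_finite) id
    have hg_I := hg (Equiv.ofBijective I hI.bijective_of_finite) id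
    rw [h, ← hg_I] at hf_I
    exact hf_I
  · rw [hf.eq_zero_of_not_injective hI, hg.eq_zero_of_not_injective hI]

end Alternating

section AlternatingMatrix

open Equiv

variable {R : Type*} [Ring R] {n m : ℕ}

theorem IsAlternating.mul_right {ι κ : Type*} [Fintype ι] [DecidableEq ι] {f : (ι → κ) → R}
    (hf : IsAlternating f) (x : R) : IsAlternating fun I => f I * x := fun σ I => by
  simp only [hf σ I, smul_mul_assoc]

theorem isAlternating_antisymmetrizer_mul (M : Matrix (Fin m → Fin n) (Fin m → Fin n) R)
    (J : Fin m → Fin n) : IsAlternating fun I => (antisymmetrizer R n m * M) I J := fun σ I => by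
  simp only
  rw [← tensorPerm_mul_apply σ (antisymmetrizer R n m * M), ← mul_assoc,
    antisymmetrizer_eq_partialAntisymmetrizer, apply_mul_partialAntisymmetrizer (by simp),
    smul_mul_assoc, Matrix.smul_apply]

theorem isAlternating_mul_antisymmetrizer (M : Matrix (Fin m → Fin n) (Fin m → Fin n) R)
    (I : Fin m → Fin n) : IsAlternating fun J => (M * antisymmetrizer R n m) I J := fun σ J => by
  simp only
  rw [show J ∘ σ = J ∘ σ.symm.symm from rfl,
    ← mul_tensorPerm_apply σ.symm (M * antisymmetrizer R n m), mul_assoc,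
    antisymmetrizer_eq_partialAntisymmetrizer,
    partialAntisymmetrizer_mul_apply (by simp), mul_smul_comm, Matrix.smul_apply, Perm.sign_symm]

theorem antisymmetrizer_id (R : Type*) [Ring R] (m : ℕ) : antisymmetrizer R m m id id = 1 := by
  rw [antisymmetrizer, Matrix.of_apply, sum_eq_single 1]
  · simp
  · exact fun σ _ hσ => if_neg fun h => hσ (Equiv.ext fun i => (congrFun h i).symm)
  · simp

variable [IsAddTorsionFree R]

theorem antisymmetrizer_eq_zero (h : n < m) : antisymmetrizer R n m = 0 := by
  ext I J
  have hI : ¬ Function.Injective I := fun hI => h.not_ge <| by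
    simpa using Fintype.card_le_of_injective I hI
  simpa using (isAlternating_antisymmetrizer_mul (1 : Matrix _ _ R) J).eq_zero_of_not_injective hI

/-- Both sides are alternating in the rows and in the columns. -/
theorem eq_antisymmetrizer_mul_scalar {M : Matrix (Fin m → Fin m) (Fin m → Fin m) R}
    (hrow : ∀ J, IsAlternating fun I => M I J) (hcol : ∀ I, IsAlternating fun J => M I J) :
    M = antisymmetrizer R m m * Matrix.scalar (Fin m → Fin m) (M id id) := by
  have hrow_A : IsAlternating fun I => antisymmetrizer R m m I id := by
    simpa using isAlternating_antisymmetrizer_mul (1 : Matrix _ _ R) id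
  have hcol_A (I : Fin m → Fin m) : IsAlternating (antisymmetrizer R m m I) := by
    simpa using isAlternating_mul_antisymmetrizer (1 : Matrix _ _ R) I
  have hid : (fun I => M I id) = fun I => antisymmetrizer R m m I id * M id id :=
    (hrow id).ext (hrow_A.mul_right _) (by rw [antisymmetrizer_id, one_mul])
  ext1 I J
  rw [Matrix.scalar_apply, Matrix.mul_diagonal]
  exact congrFun ((hcol I).ext ((hcol_A I).mul_right _) (congrFun hid I)) J

end AlternatingMatrix

section QuantumDeterminant

open Equiv

theorem sum_perm_fixing_compl_map {α β V : Type*} [Fintype α] [Fintype β] [DecidableEq β]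
    [AddCommMonoid V] [DecidableEq α] (e : α ↪ β)
    [DecidablePred fun σ : Perm β => ∀ b ∉ univ.map e, σ b = b] (g : Perm β → V) :
    ∑ σ : Perm β with ∀ b ∉ univ.map e, σ b = b, g σ =
      ∑ τ : Perm α, g (τ.viaFintypeEmbedding e) := by
  symm
  refine sum_nbij (fun τ => τ.viaFintypeEmbedding e) (fun τ _ => ?_) (fun τ _ τ' _ h => ?_)
    (fun σ hσ => ?_) fun τ _ => rfl
  · rw [mem_filter_univ]
    exact fun b hb => τ.viaFintypeEmbedding_apply_notMem_range e (by simpa using hb)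
  · ext a
    refine e.injective ?_
    rw [← τ.viaFintypeEmbedding_apply_image, ← τ'.viaFintypeEmbedding_apply_image]
    exact congrArg (· (e a)) h
  · have hfix : ∀ b ∉ Set.range e, σ b = b := by simpa using hσ
    have hmaps (b : β) : σ b ∈ Set.range e ↔ b ∈ Set.range e := by
      refine ⟨fun h => by_contra fun hb => hb (hfix b hb ▸ h), fun h => by_contra fun hb => hb ?_⟩
      rwa [σ.injective (hfix _ hb)]
    refine ⟨e.toEquivRange.symm.permCongr (σ.subtypePerm hmaps), mem_coe.2 (mem_univ _), ?_⟩
    ext b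
    by_cases hb : b ∈ Set.range e
    · obtain ⟨a, rfl⟩ := hb
      rw [Perm.viaFintypeEmbedding_apply_image]
      exact congrArg Subtype.val (e.toEquivRange.apply_symm_apply _)
    · rw [Perm.viaFintypeEmbedding_apply_notMem_range _ _ hb, hfix b hb]

variable {A : Type*} [Ring A] [Algebra ℂ A] {m n N : ℕ}

/-- The quantum determinant
`∑_σ sgn σ · s_{σ(1)1}(u) s_{σ(2)2}(u - 1) ⋯ s_{σ(m)m}(u - m + 1)` of an `m × m` matrix `S(u)`. -/
noncomputable def qdet (S : Matrix (Fin m) (Fin m) A⟦X⟧) : A⟦X⟧ :=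
  ∑ σ : Perm (Fin m),
    Perm.sign σ • ((List.finRange m).map fun a => shift (a.val : ℂ) (S (σ a) a)).prod

/-- The matrix `S_a(u - c a)` on `N` copies; the shift `c a` depends on the copy. -/
noncomputable def shiftedCopy (S : Matrix (Fin n) (Fin n) A⟦X⟧) (c : Fin N → ℂ) (a : Fin N) :
    Matrix (Fin N → Fin n) (Fin N → Fin n) A⟦X⟧ :=
  onCopy N (S.map (shift (c a))) a

theorem IsYangianMatrix.isRTTFamily_shiftedCopy {S : Matrix (Fin n) (Fin n) A⟦X⟧}
    (hS : IsYangianMatrix S) (c : Fin N → ℂ) :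
    IsRTTFamily (tensorPerm A⟦X⟧ n N) c (shiftedCopy S c) where
  commute_of_fixed hσ := commute_tensorPerm_onCopy _ hσ
  rMatrix_mul hab := onCopy_rtt (fun i j k l => hS.shift_comm i j k l _ _) hab

/-- The product of the matrices `shiftedCopy S c a` over a list of copies `a`, multiplied on the
left by the antisymmetrizer on these copies. -/
noncomputable def antisymmetrizedProd (S : Matrix (Fin n) (Fin n) A⟦X⟧) (c : Fin N → ℂ)
    (l : List (Fin N)) : Matrix (Fin N → Fin n) (Fin N → Fin n) A⟦X⟧ :=
  partialAntisymmetrizer (tensorPerm A⟦X⟧ n N) l.toFinset * (l.map (shiftedCopy S c)).prod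

/-- The entries are quantum minors. -/
theorem antisymmetrizedProd_apply (S : Matrix (Fin n) (Fin n) A⟦X⟧) {c : Fin N → ℂ}
    (e : Fin m ↪ Fin N) (hc : ∀ a, c (e a) = a.val) (I J : Fin N → Fin n) :
    antisymmetrizedProd S c ((List.finRange m).map e) I J =
      if ∀ b ∉ univ.map e, I b = J b then qdet (S.submatrix (I ∘ e) (J ∘ e)) else 0 := by
  have htoFinset : ((List.finRange m).map e).toFinset = univ.map e := by
    ext b
    simp
  have hentry (τ : Perm (Fin m)) :
      (tensorPerm A⟦X⟧ n N (τ.viaFintypeEmbedding e) *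
        (((List.finRange m).map e).map (shiftedCopy S c)).prod) I J =
      if ∀ b ∉ univ.map e, I b = J b then
        ((List.finRange m).map fun a => shift (a.val : ℂ) (S (I (e (τ a))) (J (e a)))).prod
      else 0 := by
    unfold shiftedCopy
    rw [tensorPerm_mul_apply,
      onCopy_list_prod_apply _ ((List.nodup_finRange m).map e.injective)]
    refine if_congr (forall_congr' fun b => ?_) ?_ rfl
    · rw [← htoFinset, List.mem_toFinset]
      refine forall_congr' fun hb => ?_
      rw [Function.comp_apply,
        Perm.viaFintypeEmbedding_apply_notMem_range _ _ (by simpa using hb)]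
    · simp [Function.comp_def, hc]
  rw [antisymmetrizedProd, partialAntisymmetrizer, htoFinset, sum_perm_fixing_compl_map, sum_mul,
    Matrix.sum_apply]
  simp only [smul_mul_assoc, Matrix.smul_apply, hentry, Perm.viaFintypeEmbedding_sign]
  split_ifs
  · rfl
  · simp

variable {S : Matrix (Fin m) (Fin m) A⟦X⟧}

theorem qdet_of_size_zero (S : Matrix (Fin 0) (Fin 0) A⟦X⟧) : qdet S = 1 := by
  simp [qdet]

theorem qdet_of_size_one (S : Matrix (Fin 1) (Fin 1) A⟦X⟧) : qdet S = S 0 0 := by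
  simp [qdet, List.finRange_succ, shift_zero]

theorem IsYangianMatrix.constantCoeff_qdet (hS : IsYangianMatrix S) :
    constantCoeff (qdet S) = 1 := by
  have hterm (σ : Perm (Fin m)) (l : List (Fin m)) :
      constantCoeff (l.map fun a => shift (a.val : ℂ) (S (σ a) a)).prod =
        if ∀ a ∈ l, σ a = a then 1 else 0 := by
    induction l with
    | nil => simp
    | cons a l ih =>
      rw [List.map_cons, List.prod_cons, map_mul, ih, constantCoeff_shift, hS.constantCoeff_eq]
      simp [← ite_and, and_comm]
  rw [qdet, map_sum, sum_eq_single 1]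
  · rw [Perm.sign_one, one_smul, hterm]
    simp
  · intro σ _ hσ
    rw [Units.smul_def, map_zsmul, hterm, if_neg, smul_zero]
    exact fun h => hσ (Equiv.ext fun a => h a (List.mem_finRange a))
  · simp

theorem commute_qdet {y : A⟦X⟧} (h : ∀ i j c, Commute y (shift c (S i j))) :
    Commute y (qdet S) :=
  Commute.sum_right _ _ _ fun σ _ => Commute.smul_right
    (Commute.list_prod_right _ _ fun x hx => by
      obtain ⟨a, _, rfl⟩ := List.mem_map.1 hx
      exact h _ _ _) _

instance : IsAddTorsionFree A⟦X⟧ :=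
  let _ : Module ℚ A⟦X⟧ := Module.compHom A⟦X⟧ (algebraMap ℚ ℂ)
  .of_module_rat A⟦X⟧

theorem isChain_finRange (m : ℕ) :
    (List.finRange m).IsChain fun a b => (b.val : ℂ) = a.val + 1 := by
  simp [List.isChain_iff_getElem]

/-- The list `S_1(u), S_2(u - 1), …, S_m(u - m + 1)`. -/
noncomputable def copyList (S : Matrix (Fin n) (Fin n) A⟦X⟧) (m : ℕ) :
    List (Matrix (Fin m → Fin n) (Fin m → Fin n) A⟦X⟧) :=
  (List.finRange m).map (shiftedCopy S fun a => (a.val : ℂ))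

theorem antisymmetrizer_mul_copyList_prod_apply (S : Matrix (Fin n) (Fin n) A⟦X⟧)
    (I J : Fin m → Fin n) :
    (antisymmetrizer A⟦X⟧ n m * (copyList S m).prod) I J = qdet (S.submatrix I J) := by
  have h := antisymmetrizedProd_apply S (c := fun a => (a.val : ℂ)) (.refl (Fin m))
    (fun _ => rfl) I J
  rw [show ⇑(Function.Embedding.refl (Fin m)) = id from rfl] at h
  rw [antisymmetrizer_eq_partialAntisymmetrizer, copyList]
  simpa [antisymmetrizedProd] using h

theorem IsYangianMatrix.antisymmetrizer_mul_copyList_prod {S : Matrix (Fin n) (Fin n) A⟦X⟧}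
    (hS : IsYangianMatrix S) (m : ℕ) :
    antisymmetrizer A⟦X⟧ n m * (copyList S m).prod =
      (copyList S m).reverse.prod * antisymmetrizer A⟦X⟧ n m := by
  have h := (hS.isRTTFamily_shiftedCopy fun a => (a.val : ℂ)).partialAntisymmetrizer_mul_prod
    (List.nodup_finRange m) (isChain_finRange m)
    (Nat.cast_injective.comp Fin.val_injective).injOn
  rwa [List.toFinset_finRange, ← antisymmetrizer_eq_partialAntisymmetrizer, List.map_reverse] at h

theorem IsYangianMatrix.isAlternating_qdet_submatrix {S : Matrix (Fin n) (Fin n) A⟦X⟧}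
    (hS : IsYangianMatrix S) (I : Fin m → Fin n) :
    IsAlternating fun J => qdet (S.submatrix I J) := by
  simp only [← antisymmetrizer_mul_copyList_prod_apply, hS.antisymmetrizer_mul_copyList_prod]
  exact isAlternating_mul_antisymmetrizer _ I

theorem IsYangianMatrix.antisymmetrizer_mul_copyList_prod_eq_scalar (hS : IsYangianMatrix S) :
    antisymmetrizer A⟦X⟧ m m * (copyList S m).prod =
      antisymmetrizer A⟦X⟧ m m * Matrix.scalar (Fin m → Fin m) (qdet S) := by
  have h := eq_antisymmetrizer_mul_scalar (isAlternating_antisymmetrizer_mul (copyList S m).prod)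
    fun I => by
      rw [hS.antisymmetrizer_mul_copyList_prod]
      exact isAlternating_mul_antisymmetrizer _ I
  rwa [antisymmetrizer_mul_copyList_prod_apply, Matrix.submatrix_id_id] at h

theorem partialAntisymmetrizer_insert_last_eq_zero (R : Type*) [Ring R] [IsAddTorsionFree R]
    (m : ℕ) : partialAntisymmetrizer (tensorPerm R m (m + 1))
      (insert (Fin.last m) ((List.finRange m).map Fin.castSucc).toFinset) = 0 := by
  rw [← antisymmetrizer_eq_zero (Nat.lt_succ_self m), antisymmetrizer_eq_partialAntisymmetrizer]
  congr 1
  ext a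
  cases a using Fin.lastCases <;> simp

theorem IsYangianMatrix.commute_shiftedCopy_last (hS : IsYangianMatrix S) {d : ℂ}
    (hd : ∀ r : ℕ, (r : ℂ) ≠ d) (hgap : d ≠ -1) :
    Commute (shiftedCopy S (Fin.snoc (fun a : Fin m => (a.val : ℂ)) d) (Fin.last m))
      (antisymmetrizedProd S (Fin.snoc (fun a : Fin m => (a.val : ℂ)) d)
        ((List.finRange m).map Fin.castSucc)) := by
  rcases m with _ | m
  · simp [antisymmetrizedProd, partialAntisymmetrizer_empty]
  set c : Fin (m + 2) → ℂ := Fin.snoc (fun a : Fin (m + 1) => (a.val : ℂ)) d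
  have hc_castSucc (a : Fin (m + 1)) : c a.castSucc = a.val := by simp [c]
  have hc_last : c (Fin.last (m + 1)) = d := by simp [c]
  have hchain : ((List.finRange (m + 1)).map Fin.castSucc).IsChain fun i j => c j = c i + 1 := by
    simpa only [List.isChain_map, hc_castSucc] using isChain_finRange (m + 1)
  have hinj : Set.InjOn c {a | a ∈ (List.finRange (m + 1)).map Fin.castSucc} := by
    rintro _ ha _ hb h
    obtain ⟨a, -, rfl⟩ := List.mem_map.1 ha
    obtain ⟨b, -, rfl⟩ := List.mem_map.1 hb
    rw [hc_castSucc, hc_castSucc, Nat.cast_inj] at h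
    rw [Fin.ext h]
  have hnodup : (Fin.last (m + 1) :: (List.finRange (m + 1)).map Fin.castSucc).Nodup := by
    simpa [Fin.castSucc_ne_last] using (List.nodup_finRange _).map (Fin.castSucc_injective _)
  have hzero := partialAntisymmetrizer_insert_last_eq_zero A⟦X⟧ (m + 1)
  rw [List.finRange_succ, List.map_cons] at *
  refine (hS.isRTTFamily_shiftedCopy c).commute_of_partialAntisymmetrizer_insert_eq_zero hnodup
    hchain hinj (fun j hj => ?_) ?_ hzero
  · obtain ⟨a, -, rfl⟩ := List.mem_map.1 hj
    rw [hc_castSucc, hc_last]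
    exact hd _
  · rw [hc_castSucc, hc_last, Fin.val_zero, Nat.cast_zero, ne_comm, ne_eq, add_eq_zero_iff_eq_neg]
    exact hgap

/-- The antisymmetrizer on one more copy, the last one, vanishes for dimension reasons. The
parameter `c` of this copy is generic but not arbitrary; the case of all `c` follows by polynomial
dependence of the coefficients on `c`. -/
theorem IsYangianMatrix.commute_shift_qdet (hS : IsYangianMatrix S) (i j : Fin m) (c : ℂ) :
    Commute (shift c (S i j)) (qdet S) := by
  have hinf : (Set.range fun k : ℕ => -((k : ℂ) + 2)).Infinite :=
    Set.infinite_range_of_injective fun k l h => by simpa using h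
  refine commute_shift_of_infinite hinf ?_ c
  rintro _ ⟨k, rfl⟩
  change Commute (shift (-((k : ℂ) + 2)) (S i j)) (qdet S)
  generalize hd : -((k : ℂ) + 2) = d
  have hd_nat (r : ℕ) : (r : ℂ) ≠ d := by
    rw [← hd, ne_eq, eq_neg_iff_add_eq_zero]
    exact_mod_cast (by omega : r + (k + 2) ≠ 0)
  have hd_gap : d ≠ -1 := by
    rw [← hd, ne_eq, neg_inj]
    exact_mod_cast (by omega : k + 2 ≠ 1)
  have hentry (a b : Fin m) :
      antisymmetrizedProd S (Fin.snoc (fun a : Fin m => (a.val : ℂ)) d)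
        ((List.finRange m).map Fin.castSucc) (Fin.snoc id a) (Fin.snoc id b) =
      if a = b then qdet S else 0 := by
    have h := antisymmetrizedProd_apply S
      (c := Fin.snoc (fun a : Fin m => (a.val : ℂ)) d) Fin.castSuccEmb (by simp)
      (Fin.snoc id a) (Fin.snoc id b)
    rw [Fin.coe_castSuccEmb] at h
    rw [h]
    refine if_congr (by simp [Fin.forall_fin_succ']) ?_ rfl
    congr 1
    ext1 p q
    simp
  have h := congrFun₂ (hS.commute_shiftedCopy_last hd_nat hd_gap).eq (Fin.snoc id i)
    (Fin.snoc id j)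
  rw [shiftedCopy, onCopy_mul_apply, mul_onCopy_apply] at h
  simpa [Fin.update_snoc_last, hentry, commute_iff_eq] using h

/-- The entries of the last row of the quantum comatrix. -/
noncomputable def lastCofactor (S : Matrix (Fin (m + 1)) (Fin (m + 1)) A⟦X⟧) (i : Fin (m + 1)) :
    A⟦X⟧ :=
  ∑ σ : Perm (Fin (m + 1)) with σ (Fin.last m) = i, Perm.sign σ •
    ((List.finRange m).map fun a => shift (a.val : ℂ) (S (σ a.castSucc) a.castSucc)).prod

theorem lastCofactor_last (S : Matrix (Fin (m + 1)) (Fin (m + 1)) A⟦X⟧) :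
    lastCofactor S (Fin.last m) = qdet (S.submatrix Fin.castSucc Fin.castSucc) := by
  have hfix (σ : Perm (Fin (m + 1))) : σ (Fin.last m) = Fin.last m ↔
      ∀ b ∉ univ.map Fin.castSuccEmb, σ b = b := by
    simp [Fin.forall_fin_succ']
  have hcast (τ : Perm (Fin m)) (a : Fin m) :
      τ.viaFintypeEmbedding Fin.castSuccEmb a.castSucc = (τ a).castSucc :=
    τ.viaFintypeEmbedding_apply_image Fin.castSuccEmb a
  rw [lastCofactor]
  simp only [hfix]
  rw [sum_perm_fixing_compl_map]
  simp only [Perm.viaFintypeEmbedding_sign, hcast, qdet, Matrix.submatrix_apply]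

theorem sum_lastCofactor_mul (S : Matrix (Fin (m + 1)) (Fin (m + 1)) A⟦X⟧) (j : Fin (m + 1)) :
    ∑ i, lastCofactor S i * shift (m : ℂ) (S i j) =
      qdet (S.submatrix id (Function.update id (Fin.last m) j)) := by
  rw [qdet, ← sum_fiberwise univ fun σ : Perm (Fin (m + 1)) => σ (Fin.last m)]
  refine sum_congr rfl fun i _ => ?_
  rw [lastCofactor, sum_mul]
  refine sum_congr rfl fun σ hσ => ?_
  rw [← (mem_filter.1 hσ).2]
  simp [List.finRange_succ_last, Function.comp_def, smul_mul_assoc]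

theorem IsYangianMatrix.sum_lastCofactor_mul {S : Matrix (Fin (m + 1)) (Fin (m + 1)) A⟦X⟧}
    (hS : IsYangianMatrix S) (j : Fin (m + 1)) :
    ∑ i, lastCofactor S i * shift (m : ℂ) (S i j) = if j = Fin.last m then qdet S else 0 := by
  rw [Yangian.sum_lastCofactor_mul]
  split_ifs with hj
  · rw [hj, show Function.update id (Fin.last m) (Fin.last m) = id from
      Function.update_eq_self _ id, Matrix.submatrix_id_id]
  · refine (hS.isAlternating_qdet_submatrix id).eq_zero_of_not_injective fun hinj => hj (hinj ?_)
    rw [Function.update_self, Function.update_of_ne hj, id]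

end QuantumDeterminant

section QuasiDeterminant

variable {R : Type*} [Ring R] {ι : Type*} [Fintype ι] [DecidableEq ι]

variable (R ι) in
/-- The homomorphism that regards a series with matrix coefficients as a matrix of series. -/
noncomputable def matrixOfSeries : (Matrix ι ι R)⟦X⟧ →+* Matrix ι ι R⟦X⟧ where
  toFun f := Matrix.of fun i j => mk fun N => coeff N f i j
  map_one' := by
    ext i j N
    simp only [Matrix.of_apply, coeff_mk, coeff_one, Matrix.one_apply]
    split_ifs <;> simp_all [coeff_one, Matrix.one_apply]
  map_zero' := by ext; simp
  map_add' f g := by ext; simp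
  map_mul' f g := by
    ext i j N
    simp only [Matrix.of_apply, coeff_mk, Matrix.mul_apply, coeff_mul, map_sum, Matrix.sum_apply]
    exact sum_comm

theorem isUnit_matrix_of_constantCoeff {Z : Matrix ι ι R⟦X⟧}
    (h : ∀ i j, constantCoeff (Z i j) = if i = j then 1 else 0) : IsUnit Z := by
  let f : (Matrix ι ι R)⟦X⟧ := mk fun N => Matrix.of fun i j => coeff N (Z i j)
  have hf : matrixOfSeries R ι f = Z := by
    ext i j N
    simp [matrixOfSeries, f]
  rw [← hf]
  refine (isUnit_of_constantCoeff_eq_one ?_).map _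
  ext i j
  rw [← coeff_zero_eq_constantCoeff_apply, coeff_mk, Matrix.of_apply,
    coeff_zero_eq_constantCoeff_apply, h, Matrix.one_apply]

theorem eq_mul_inverse_apply_of_vecMul_eq_single {Z : Matrix ι ι R} (hZ : IsUnit Z) {h : ι → R}
    {j : ι} {D : R} (hmul : Matrix.vecMul h Z = Pi.single j D) (i : ι) :
    h i = D * Ring.inverse Z j i := by
  have hh : h = Matrix.vecMul (Pi.single j D) (Ring.inverse Z) := by
    rw [← hmul, Matrix.vecMul_vecMul, Ring.mul_inverse_cancel _ hZ, Matrix.vecMul_one]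
  rw [hh, Matrix.single_vecMul, Pi.smul_apply, Matrix.row_apply, smul_eq_mul]

theorem hasQuasiDet_and_quasiDet_eq {m : ℕ} {Z : Matrix (Fin m) (Fin m) R} (hZ : IsUnit Z)
    {i j : Fin m} {D D' : Rˣ} (h : (D' : R) = D * Ring.inverse Z j i) :
    HasQuasiDet Z i j ∧ quasiDet Z i j = ↑(D'⁻¹ * D) := by
  have hentry : Ring.inverse Z j i = ↑(D⁻¹ * D') := by
    rw [Units.val_mul, h, Units.inv_mul_cancel_left]
  refine ⟨⟨hZ, hentry ▸ Units.isUnit _⟩, ?_⟩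
  rw [quasiDet, hentry, Ring.inverse_unit, mul_inv_rev, inv_inv]

variable {A : Type*} [Ring A] [Algebra ℂ A] {m : ℕ}

theorem IsYangianMatrix.isUnit_map_shift {S : Matrix ι ι A⟦X⟧} (hS : IsYangianMatrix S) (c : ℂ) :
    IsUnit (S.map (shift c)) :=
  isUnit_matrix_of_constantCoeff fun i j => by
    rw [Matrix.map_apply, constantCoeff_shift, hS.constantCoeff_eq]

theorem IsYangianMatrix.isUnit_qdet {S : Matrix (Fin m) (Fin m) A⟦X⟧} (hS : IsYangianMatrix S) :
    IsUnit (qdet S) :=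
  isUnit_of_constantCoeff_eq_one hS.constantCoeff_qdet

theorem IsYangianMatrix.hasQuasiDet_and_quasiDet_last_eq
    {S : Matrix (Fin (m + 1)) (Fin (m + 1)) A⟦X⟧} (hS : IsYangianMatrix S) :
    HasQuasiDet (S.map (shift (m : ℂ))) (Fin.last m) (Fin.last m) ∧
      quasiDet (S.map (shift (m : ℂ))) (Fin.last m) (Fin.last m) =
        ↑((hS.submatrix (Fin.castSucc_injective m)).isUnit_qdet.unit⁻¹ *
          hS.isUnit_qdet.unit) := by
  have hrow : Matrix.vecMul (lastCofactor S) (S.map (shift (m : ℂ))) =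
      Pi.single (Fin.last m) (qdet S) := by
    ext1 j
    rw [Pi.single_apply, ← hS.sum_lastCofactor_mul j]
    rfl
  refine hasQuasiDet_and_quasiDet_eq (hS.isUnit_map_shift m) ?_
  rw [IsUnit.unit_spec, IsUnit.unit_spec, ← lastCofactor_last]
  exact eq_mul_inverse_apply_of_vecMul_eq_single (hS.isUnit_map_shift m) hrow _

end QuasiDeterminant

section LeadingMinors

variable (n : ℕ)

theorem isYangianMatrix_principal (k : ℕ) (hk : k ≤ n) :
    IsYangianMatrix ((T n).submatrix (Fin.castLE hk) (Fin.castLE hk)) :=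
  (isYangianMatrix_T n).submatrix (Fin.castLE_injective hk)

/-- The series `qdet T^{(k)}(u)`, as a unit. -/
noncomputable def principalQdet (k : ℕ) (hk : k ≤ n) : (Y n)⟦X⟧ˣ :=
  (isYangianMatrix_principal n k hk).isUnit_qdet.unit

theorem commute_principalQdet (k l : ℕ) (hk : k ≤ n) (hl : l ≤ n) :
    Commute (principalQdet n k hk) (principalQdet n l hl) := by
  wlog h : k ≤ l generalizing k l
  · exact (this l k hl hk (Nat.le_of_not_le h)).symm
  rw [← Commute.units_val_iff]
  exact (commute_qdet fun i j c => ((isYangianMatrix_principal n l hl).commute_shift_qdet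
    (Fin.castLE h i) (Fin.castLE h j) c).symm).symm

theorem hasQuasiDet_leadingT_and_factor_eq (k : Fin n) :
    HasQuasiDet (leadingT n k) (Fin.last k.val) (Fin.last k.val) ∧
      factor n k =
        ↑((principalQdet n k.val k.isLt.le)⁻¹ * principalQdet n (k.val + 1) k.isLt) :=
  (isYangianMatrix_principal n (k.val + 1) k.isLt).hasQuasiDet_and_quasiDet_last_eq

theorem commute_factor (k l : Fin n) : Commute (factor n k) (factor n l) := by
  rw [(hasQuasiDet_leadingT_and_factor_eq n k).2, (hasQuasiDet_leadingT_and_factor_eq n l).2,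
    Commute.units_val_iff]
  have h := commute_principalQdet n
  exact ((h _ _ _ _).inv_inv.mul_right (h _ _ _ _).inv_left).mul_left
    ((h _ _ _ _).inv_right.mul_right (h _ _ _ _))

theorem prod_factor (k : ℕ) (hk : k ≤ n) :
    (List.ofFn fun i : Fin k => factor n (Fin.castLE hk i)).prod = principalQdet n k hk := by
  induction k with
  | zero => exact (qdet_of_size_zero _).symm
  | succ k ih =>
    rw [List.ofFn_succ', List.concat_eq_append, List.prod_append, List.prod_singleton]
    refine (congrArg (· * _) (ih (Nat.le_of_succ_le hk))).trans ?_
    rw [(hasQuasiDet_leadingT_and_factor_eq n _).2, ← Units.val_mul]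
    exact congrArg _ (mul_inv_cancel_left _ _)

theorem factor_zero (hn : 1 ≤ n) : factor n ⟨0, hn⟩ = T n ⟨0, hn⟩ ⟨0, hn⟩ := by
  have h := prod_factor n 1 hn
  rw [List.ofFn_succ, List.ofFn_zero, List.prod_singleton] at h
  exact h.trans (qdet_of_size_one _)

theorem tList_eq_copyList : tList n = copyList (T n) n :=
  List.ofFn_eq_map

theorem isQuantumDeterminant_qdet : IsQuantumDeterminant n (qdet (T n)) where
  constantCoeff_eq := (isYangianMatrix_T n).constantCoeff_qdet
  antisymmetrizer_mul := by
    rw [tList_eq_copyList, (isYangianMatrix_T n).antisymmetrizer_mul_copyList_prod_eq_scalar]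
  mul_antisymmetrizer := by
    rw [tList_eq_copyList, ← (isYangianMatrix_T n).antisymmetrizer_mul_copyList_prod,
      (isYangianMatrix_T n).antisymmetrizer_mul_copyList_prod_eq_scalar]

theorem isQuantumDeterminant_iff (D : (Y n)⟦X⟧) : IsQuantumDeterminant n D ↔ D = qdet (T n) := by
  refine ⟨fun h => ?_, fun h => h ▸ isQuantumDeterminant_qdet n⟩
  have heq := congrFun₂
    (h.antisymmetrizer_mul.symm.trans (isQuantumDeterminant_qdet n).antisymmetrizer_mul) id id
  simpa [Matrix.scalar_apply, Matrix.mul_diagonal, antisymmetrizer_id] using heq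

end LeadingMinors

end Yangian

/-- The quantum determinant exists and is unique; all the quasi-determinants
`|T^{(m)}(u - m + 1)|_{mm}` are defined, the one for `m = 1` being `t_{11}(u)`; the quantum
determinant is the product of these in the order `m = 1, …, n`; and they commute pairwise. -/
theorem mainTheorem6 (n : ℕ) (hn : 1 ≤ n) :
    (∃! D : PowerSeries (Yangian.Y n), Yangian.IsQuantumDeterminant n D) ∧
    (∀ k : Fin n, Yangian.HasQuasiDet (Yangian.leadingT n k) (Fin.last k.val) (Fin.last k.val)) ∧
    Yangian.factor n ⟨0, hn⟩ = Yangian.T n ⟨0, hn⟩ ⟨0, hn⟩ ∧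
    (∀ D : PowerSeries (Yangian.Y n), Yangian.IsQuantumDeterminant n D →
      D = (List.ofFn (Yangian.factor n)).prod) ∧
    (∀ k l : Fin n, Commute (Yangian.factor n k) (Yangian.factor n l)) := by
  refine ⟨⟨Yangian.qdet (Yangian.T n), Yangian.isQuantumDeterminant_qdet n,
      fun D hD => (Yangian.isQuantumDeterminant_iff n D).1 hD⟩,
    fun k => (Yangian.hasQuasiDet_leadingT_and_factor_eq n k).1, Yangian.factor_zero n hn,
    fun D hD => ?_, Yangian.commute_factor n⟩
  rw [(Yangian.isQuantumDeterminant_iff n D).1 hD]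
  exact (Yangian.prod_factor n n le_rfl).symm
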